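/- For $n\ge 1$ let $X^{(n)}=(X^{(n)}_t)_{t\ge0}$ be the additive Marcus--Lushnikov process of total mass $n$: the continuous-time Markov chain on partitions of the integer $n$ (multisets of cluster sizes) that starts from $n$ clusters of size $1$ and in which each pair of clusters, of sizes $x$ and $y$, merges into one cluster of size $x+y$ at rate $(x+y)/n$. For $1\le k\le n-1$ let $S_{k,n}\ge s_{k,n}$ be the sizes of the two clusters that merge at the $k$-th jump. Given the sizes $(S_{k,n},s_{k,n})_{1\le k\le n-1}$, let $L_{1,n},\dots,L_{n-1,n}$ be independent size-biased picks: $L_{k,n}=S_{k,n}$ with probability $S_{k,n}/(S_{k,n}+s_{k,n})$ and $L_{k,n}=s_{k,n}$ with probability $s_{k,n}/(S_{k,n}+s_{k,n})$. Put \[ R_{k,n}=S_{k,n}+s_{k,n}-L_{k,n},\qquad C^{QFB}_{n,m}=\sum_{k=1}^{m}R_{k,n}. \] Then the total Quick-Find-Biased cost satisfies \[ \frac{C^{QFB}_{n,n-1}}{n\log n}\ \longrightarrow\ \frac12\quad\text{in }L^2\text{ as }n\to\infty, \qquad\text{i.e.}\qquad \mathbb E\left[\left(\frac{C^{QFB}_{n,n-1}}{n\log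 n}-\frac12\right)^{2}\right]\longrightarrow 0, \] where $\log$ is the natural logarithm. -/

import Mathlib

open MeasureTheory Filter
open scoped Topology NNReal ENNReal

noncomputable section

namespace MarcusLushnikov

/-- Merging a cluster of size `x` with a cluster of size `y`. A state is the multiset of the
cluster sizes. -/
def merge (m : Multiset ℕ) (x y : ℕ) : Multiset ℕ :=
  (m - {x, y}) + {x + y}

/-- The state reached from the monodisperse configuration (`n` clusters of size `1`) after
`k` jumps, if the jump number `i + 1` merges clusters of sizes `x i` and `y i`. -/
def clusters (n : ℕ) (x y : ℕ → ℕ) : ℕ → Multiset ℕ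
  | 0 => Multiset.replicate n 1
  | k + 1 => merge (clusters n x y k) (x k) (y k)

/-- The number of (unordered) pairs of distinct clusters of the state `m` whose sizes are `x`
and `y`. -/
def numPairs (m : Multiset ℕ) (x y : ℕ) : ℕ :=
  (m.powersetCard 2).count {x, y}

/-- The rate at which some cluster of size `x` merges with some cluster of size `y` in the
state `m`: each pair of clusters of sizes `x`, `y` merges at rate `K x y / n`. -/
def jumpRate (K : ℕ → ℕ → ℝ) (n : ℕ) (m : Multiset ℕ) (x y : ℕ) : ℝ :=
  numPairs m x y * (K x y / n)

/-- The total jump rate in the state `m`, a multiset of cluster sizes in `{1, …, n}`. -/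
def totalRate (K : ℕ → ℕ → ℝ) (n : ℕ) (m : Multiset ℕ) : ℝ :=
  ∑ x ∈ Finset.Icc 1 n, ∑ y ∈ Finset.Icc 1 x, jumpRate K n m x y

/-- The number of jumps up to time `t`, for the holding times `τ 0, τ 1, …, τ (n - 2)` of the
states visited before the `n - 1` jumps. -/
def jumpCount (n : ℕ) (τ : ℕ → ℝ) (t : ℝ≥0) : ℕ :=
  ((Finset.range (n - 1)).filter fun k => ∑ i ∈ Finset.range (k + 1), τ i ≤ t).card

/-- `X` is a Marcus–Lushnikov process with kernel `K`, of total mass `n`, started from the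
monodisperse configuration, as a continuous-time Markov chain given by its jumps and its
holding times. The jump number `k + 1` of `X` merges two clusters of sizes `S k ≥ s k`, after
`X` has spent the time `τ k` in the previous state. Given the past, in the state `m`, the holding
time is exponential with parameter `totalRate K n m` and is independent of the next pair
of sizes, which is `(x, y)` with probability `jumpRate K n m x y / totalRate K n m`; the field
`law` is the resulting joint law of the `n - 1` jumps and of the holding times. -/
structure IsMarcusLushnikov (K : ℕ → ℕ → ℝ) (n : ℕ) {Ω : Type*} [MeasurableSpace Ω]
    (P : Measure Ω) (X : ℝ≥0 → Ω → Multiset ℕ) (S s : ℕ → Ω → ℕ) (τ : ℕ → Ω → ℝ) : Prop where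
  measurable_S : ∀ k, Measurable (S k)
  measurable_s : ∀ k, Measurable (s k)
  measurable_τ : ∀ k, Measurable (τ k)
  path : ∀ᵐ ω ∂P, ∀ t, X t ω =
    clusters n (fun k => S k ω) (fun k => s k ω) (jumpCount n (fun k => τ k ω) t)
  law : ∀ (x y : ℕ → ℕ) (t : ℕ → ℝ), (∀ k, y k ≤ x k) → (∀ k, 0 ≤ t k) →
    P {ω | ∀ k < n - 1, S k ω = x k ∧ s k ω = y k ∧ t k < τ k ω} =
      ∏ k ∈ Finset.range (n - 1), ENNReal.ofReal
        (jumpRate K n (clusters n x y k) (x k) (y k) / totalRate K n (clusters n x y k) *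
          Real.exp (-totalRate K n (clusters n x y k) * t k))

/-- The additive kernel. -/
def additiveKernel (x y : ℕ) : ℝ := x + y

/-- The probability that a size-biased pick among two clusters of sizes `x` and `y` has size
`l`. -/
def sizeBiased (x y l : ℕ) : ℝ :=
  (if l = x then (x : ℝ) / (x + y) else 0) + (if l = y then (y : ℝ) / (x + y) else 0)

/-- Given the sizes `(S k, s k)` for all the `n - 1` jumps, the `L k` are independent, and `L k`
is a size-biased pick among `S k` and `s k`. -/
structure IsSizeBiasedPick (n : ℕ) {Ω : Type*} [MeasurableSpace Ω]
    (P : Measure Ω) (S s L : ℕ → Ω → ℕ) : Prop where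
  measurable_L : ∀ k, Measurable (L k)
  law : ∀ x y l : ℕ → ℕ,
    P {ω | ∀ k < n - 1, S k ω = x k ∧ s k ω = y k ∧ L k ω = l k} =
      P {ω | ∀ k < n - 1, S k ω = x k ∧ s k ω = y k} *
        ∏ k ∈ Finset.range (n - 1), ENNReal.ofReal (sizeBiased (x k) (y k) (l k))

/-- The size of the other cluster, the one that is not picked, at the jump number `k + 1`. -/
def preySize {Ω : Type*} (S s L : ℕ → Ω → ℕ) (k : ℕ) (ω : Ω) : ℝ :=
  (S k ω : ℝ) + s k ω - L k ω

/-- The cost of the first `m` jumps for Quick-Find-Biased. -/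
def costQFB {Ω : Type*} (S s L : ℕ → Ω → ℕ) (m : ℕ) (ω : Ω) : ℝ :=
  ∑ k ∈ Finset.range m, preySize S s L k ω

end MarcusLushnikov

end

/-!
Write `q` for the sum of the squares of the relative cluster sizes `x / n`. When `j` jumps remain,
the prey of the next jump (the cluster that is not picked) has mean relative size `(1 - q) / j`,
and the fluctuations of the remaining relative prey sizes have total variance at most `(1 - q) / 2`.
So `cost / n` is, up to a martingale bounded in `L²`, the sum over the jumps of `(1 - q) / j`, which
has to be compared with `log n / 2`.

For `j ≥ √n` the quantity `q` is small: it starts at `1 / n` and its mean grows at each jump by a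
factor of at most `1 + 2 / j`. These terms therefore contribute the sum of `1 / j`, about
`log n / 2`. For `j < √n` the contribution is bounded by the mean of `-2 log q` at the time when
`j = √n`, since the drift of `-2 log q` is at most `-(1 - q) / j`. And this mean is bounded
uniformly in `n`: `-log q` starts at `log n`, and its drift is about `-2 / j` as long as `j ≥ √n`.
The function `potential` combines the two estimates.
-/

noncomputable section

namespace MarcusLushnikov

section FiniteChain

variable {α σ : Type*} {w : σ → α → ℝ} {f : σ → α → σ} {A : Finset α} {I : ℕ → σ → Prop}

/-- A Markov chain with finitely many steps, seen through its transitions: in the state `s` it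
makes the step `a ∈ A`, which leads to the state `f s a`, with probability `w s a`. The predicate
`I j` confines the states from which `j` steps remain to be made. -/
structure IsFiniteChain (w : σ → α → ℝ) (f : σ → α → σ) (A : Finset α) (I : ℕ → σ → Prop) :
    Prop where
  nonneg : ∀ s a, 0 ≤ w s a
  sum_eq_one : ∀ {j s}, I (j + 1) s → ∑ a ∈ A, w s a = 1
  step : ∀ {j s a}, I (j + 1) s → w s a ≠ 0 → I j (f s a)

/-- The state reached from `s` after the first `k` of the steps `a`. -/
def traj (f : σ → α → σ) (s : σ) (a : ℕ → α) : ℕ → σ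
  | 0 => s
  | k + 1 => f (traj f s a k) (a k)

/-- The probability that the first `j` steps of the chain started at `s` are `p`. -/
def pathWeight (w : σ → α → ℝ) (f : σ → α → σ) : {j : ℕ} → σ → (Fin j → α) → ℝ
  | 0, _, _ => 1
  | _ + 1, s, p => w s (p 0) * pathWeight w f (f s (p 0)) (Fin.tail p)

/-- The expectation of `F`, a function of the first `j` steps of the chain started at `s`. -/
def pathSum (w : σ → α → ℝ) (f : σ → α → σ) (A : Finset α) {j : ℕ} (F : (Fin j → α) → ℝ)
    (s : σ) : ℝ :=
  ∑ p ∈ Fintype.piFinset fun _ => A, pathWeight w f s p * F p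

lemma traj_succ_left (f : σ → α → σ) (s : σ) (a : ℕ → α) (k : ℕ) :
    traj f s a (k + 1) = traj f (f s (a 0)) (fun i => a (i + 1)) k := by
  induction k with
  | zero => rfl
  | succ k ih => exact congrArg (f · (a (k + 1))) ih

lemma pathWeight_eq_prod (w : σ → α → ℝ) (f : σ → α → σ) (s : σ) (a : ℕ → α) (j : ℕ) :
    pathWeight w f s (fun i : Fin j => a i) = ∏ k ∈ Finset.range j, w (traj f s a k) (a k) := by
  induction j generalizing s a with
  | zero => rfl
  | succ j ih =>
    rw [Finset.prod_range_succ', mul_comm]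
    simp only [traj_succ_left]
    exact congrArg (w s (a 0) * ·) (ih (f s (a 0)) fun i => a (i + 1))

lemma pathSum_succ (w : σ → α → ℝ) (f : σ → α → σ) (A : Finset α) {j : ℕ}
    (F : (Fin (j + 1) → α) → ℝ) (s : σ) :
    pathSum w f A F s =
      ∑ a ∈ A, w s a * pathSum w f A (fun p : Fin j → α => F (Fin.cons a p)) (f s a) := by
  simp only [pathSum, Finset.mul_sum, Finset.sum_sigma']
  refine (Finset.sum_bij' (fun x _ => Fin.cons x.1 x.2) (fun p _ => ⟨p 0, Fin.tail p⟩)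
    ?_ ?_ ?_ ?_ ?_).symm
  · rintro ⟨a, p⟩ h
    simpa [Fin.forall_fin_succ] using h
  · intro p h
    simpa [Fin.forall_fin_succ, Fin.tail] using h
  · rintro ⟨a, p⟩ -
    simp
  · intro p _
    simp
  · rintro ⟨a, p⟩ -
    simp [pathWeight, mul_assoc]

lemma IsFiniteChain.sum_pathWeight (h : IsFiniteChain w f A I) {j : ℕ} {s : σ} (hs : I j s) :
    ∑ p ∈ Fintype.piFinset fun _ : Fin j => A, pathWeight w f s p = 1 := by
  suffices pathSum w f A (fun _ : Fin j → α => 1) s = 1 by simpa [pathSum] using this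
  induction j generalizing s with
  | zero => simp [pathSum, pathWeight]
  | succ j ih =>
    rw [pathSum_succ]
    refine (Finset.sum_congr rfl fun a _ => ?_).trans (h.sum_eq_one hs)
    obtain hw | hw := eq_or_ne (w s a) 0
    · simp [hw]
    · rw [ih (h.step hs hw), mul_one]

lemma sum_mul_add_sub_mean_sq_le {v X : α → ℝ} (hv : ∑ a ∈ A, v a = 1) (z : ℝ) :
    ∑ a ∈ A, v a * (z + X a - ∑ b ∈ A, v b * X b) ^ 2 ≤ z ^ 2 + ∑ a ∈ A, v a * X a ^ 2 := by
  set r := ∑ b ∈ A, v b * X b with hr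
  have expand : ∑ a ∈ A, v a * (z + X a - r) ^ 2 =
      (z - r) ^ 2 * ∑ a ∈ A, v a + 2 * (z - r) * ∑ a ∈ A, v a * X a +
        ∑ a ∈ A, v a * X a ^ 2 := by
    simp only [Finset.mul_sum, ← Finset.sum_add_distrib]
    exact Finset.sum_congr rfl fun a _ => by ring
  rw [expand, hv, ← hr]
  nlinarith [sq_nonneg r]

/- The sum of the `X` minus its target is split as `z + d`: `z` collects the centred increments
`X - E X`, whose variances add up, and `d` the differences `E X - t`, which are controlled
only in absolute value and hence enter the square through the crude bound `H`. -/
lemma IsFiniteChain.pathSum_sq_le (h : IsFiniteChain w f A I) {X : α → ℝ} {t u : ℕ → ℝ}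
    {V U : ℕ → σ → ℝ} (hV₀ : ∀ {s}, I 0 s → 0 ≤ V 0 s) (hU₀ : ∀ {s}, I 0 s → 0 ≤ U 0 s)
    (hV : ∀ {j s}, I (j + 1) s →
      ∑ a ∈ A, w s a * X a ^ 2 + ∑ a ∈ A, w s a * V j (f s a) ≤ V (j + 1) s)
    (hU : ∀ {j s}, I (j + 1) s →
      |∑ a ∈ A, w s a * X a - t j| + ∑ a ∈ A, w s a * U j (f s a) ≤ U (j + 1) s)
    (hu : ∀ {j s}, I (j + 1) s → |∑ a ∈ A, w s a * X a - t j| ≤ u j)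
    {j : ℕ} {s : σ} (hs : I j s) {z d H : ℝ} (hH₀ : 0 ≤ H)
    (hH : |d| + ∑ i ∈ Finset.range j, u i ≤ H) :
    pathSum w f A (fun p : Fin j → α =>
        (z + d + ∑ i, X (p i) - ∑ i ∈ Finset.range j, t i) ^ 2) s ≤
      2 * (z ^ 2 + V j s) + 2 * H * (|d| + U j s) := by
  induction j generalizing s z d with
  | zero =>
    have hd : |d| ≤ H := by simpa using hH
    have hHU : 0 ≤ H * U 0 s := mul_nonneg hH₀ (hU₀ hs)
    have hsq : d ^ 2 ≤ H * |d| := by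
      nlinarith [sq_abs d, mul_le_mul_of_nonneg_right hd (abs_nonneg d)]
    simp only [pathSum, pathWeight, Fintype.piFinset_of_isEmpty, Finset.univ_unique,
      Finset.sum_singleton, Finset.univ_eq_empty, Finset.sum_empty, Finset.range_zero]
    nlinarith [sq_nonneg (z - d), hV₀ hs]
  | succ j ih =>
    set r := ∑ a ∈ A, w s a * X a
    have hd : |d + (r - t j)| ≤ |d| + |r - t j| := abs_add_le _ _
    rw [pathSum_succ]
    calc ∑ a ∈ A, w s a * _
        ≤ ∑ a ∈ A, w s a * (2 * ((z + X a - r) ^ 2 + V j (f s a)) +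
            2 * H * (|d + (r - t j)| + U j (f s a))) := by
          refine Finset.sum_le_sum fun a _ => ?_
          obtain hw | hw := eq_or_ne (w s a) 0
          · simp [hw]
          refine mul_le_mul_of_nonneg_left ?_ (h.nonneg s a)
          have hH' : |d + (r - t j)| + ∑ i ∈ Finset.range j, u i ≤ H := by
            linarith [hu hs, Finset.sum_range_succ u j]
          refine le_of_eq_of_le (congrArg (pathSum w f A · (f s a)) ?_) (ih (h.step hs hw) hH')
          funext p
          rw [Fin.sum_univ_succ, Finset.sum_range_succ]
          simp only [Fin.cons_zero, Fin.cons_succ]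
          ring
      _ = 2 * (∑ a ∈ A, w s a * (z + X a - r) ^ 2 + ∑ a ∈ A, w s a * V j (f s a)) +
            2 * H * (|d + (r - t j)| * ∑ a ∈ A, w s a + ∑ a ∈ A, w s a * U j (f s a)) := by
          simp only [Finset.mul_sum, ← Finset.sum_add_distrib]
          exact Finset.sum_congr rfl fun a _ => by ring
      _ ≤ 2 * (z ^ 2 + V (j + 1) s) + 2 * H * (|d| + U (j + 1) s) := by
          have hz := sum_mul_add_sub_mean_sq_le (h.sum_eq_one hs) (X := X) z
          rw [h.sum_eq_one hs, mul_one]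
          gcongr ?_ + 2 * H * ?_
          · linarith [hV hs]
          · linarith [hU hs]

end FiniteChain

section Pairs

variable {α : Type*}

/-- The sum of `φ x y` over the ordered pairs of distinct members of `m`. -/
def offDiag (m : Multiset α) (φ : α → α → ℝ) : ℝ :=
  (m.map fun x => (m.map fun y => φ x y).sum).sum - (m.map fun x => φ x x).sum

lemma offDiag_cons (a : α) (m : Multiset α) (φ : α → α → ℝ) :
    offDiag (a ::ₘ m) φ = (m.map fun b => φ a b + φ b a).sum + offDiag m φ := by
  simp only [offDiag, Multiset.map_cons, Multiset.sum_cons, Multiset.sum_map_add]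
  ring

lemma offDiag_pair (a b : α) (φ : α → α → ℝ) : offDiag {a, b} φ = φ a b + φ b a := by
  simp only [offDiag, Multiset.insert_eq_cons, Multiset.map_cons, Multiset.map_singleton,
    Multiset.sum_cons, Multiset.sum_singleton]
  ring

lemma offDiag_mul (m : Multiset α) (u v : α → ℝ) :
    offDiag m (fun x y => u x * v y) =
      (m.map u).sum * (m.map v).sum - (m.map fun x => u x * v x).sum := by
  simp only [offDiag, Multiset.sum_map_mul_left, Multiset.sum_map_mul_right]

lemma offDiag_eq_sum_powersetCard_two (m : Multiset α) (φ : α → α → ℝ) :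
    offDiag m φ = ((m.powersetCard 2).map fun p => offDiag p φ).sum := by
  induction m using Multiset.induction_on with
  | empty => simp [offDiag, Multiset.powersetCard_zero_right]
  | cons a m ih =>
    rw [offDiag_cons, ih, Multiset.powersetCard_cons, Multiset.powersetCard_one, Multiset.map_add,
      Multiset.sum_add, add_comm, Multiset.map_map, Multiset.map_map]
    exact congrArg (_ + Multiset.sum ·)
      (Multiset.map_congr rfl fun b _ => (offDiag_pair a b φ).symm)

lemma eq_and_eq_of_pair_eq_pair {x y a b : ℕ} (hxy : y ≤ x) (hab : b ≤ a)
    (h : ({x, y} : Multiset ℕ) = {a, b}) : x = a ∧ y = b := by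
  have hsum : x + y = a + b := by simpa using congrArg Multiset.sum h
  have hx : x ∈ ({a, b} : Multiset ℕ) := h ▸ Multiset.mem_cons_self x {y}
  have ha : a ∈ ({x, y} : Multiset ℕ) := h.symm ▸ Multiset.mem_cons_self a {b}
  simp only [Multiset.insert_eq_cons, Multiset.mem_cons, Multiset.mem_singleton] at hx ha
  omega

lemma exists_pair_of_mem_powersetCard_two {m p : Multiset ℕ} (hp : p ∈ m.powersetCard 2) :
    ∃ x ∈ m, ∃ y ∈ m, y ≤ x ∧ p = {x, y} := by
  obtain ⟨hle, hcard⟩ := Multiset.mem_powersetCard.1 hp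
  obtain ⟨x, y, rfl⟩ := Multiset.card_eq_two.1 hcard
  have hx : x ∈ m := Multiset.mem_of_le hle (by simp)
  have hy : y ∈ m := Multiset.mem_of_le hle (by simp)
  obtain hxy | hxy := le_total y x
  · exact ⟨x, hx, y, hy, hxy, rfl⟩
  · exact ⟨y, hy, x, hx, hxy, Multiset.pair_comm x y⟩

lemma sum_numPairs_mul {n : ℕ} {m : Multiset ℕ} (hm : ∀ x ∈ m, x ∈ Finset.Icc 1 n)
    (φ : ℕ → ℕ → ℝ) :
    ∑ x ∈ Finset.Icc 1 n, ∑ y ∈ Finset.Icc 1 x, numPairs m x y * (φ x y + φ y x) =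
      offDiag m φ := by
  rw [offDiag_eq_sum_powersetCard_two, Finset.sum_multiset_map_count, Finset.sum_sigma']
  refine Finset.sum_bij_ne_zero (fun a _ _ => {a.1, a.2}) ?_ ?_ ?_ ?_
  · rintro ⟨x, y⟩ - h
    exact Multiset.mem_toFinset.2
      (Multiset.count_ne_zero.1 (Nat.cast_ne_zero.1 (left_ne_zero_of_mul h)))
  · rintro ⟨x, y⟩ hxy - ⟨a, b⟩ hab - h
    simp only [Finset.mem_sigma, Finset.mem_Icc] at hxy hab
    obtain ⟨rfl, rfl⟩ := eq_and_eq_of_pair_eq_pair hxy.2.2 hab.2.2 h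
    rfl
  · intro p hp h
    obtain ⟨x, hx, y, hy, hyx, rfl⟩ :=
      exists_pair_of_mem_powersetCard_two (Multiset.mem_toFinset.1 hp)
    refine ⟨⟨x, y⟩, ?_, ?_, rfl⟩
    · exact Finset.mem_sigma.2 ⟨hm x hx, Finset.mem_Icc.2 ⟨(Finset.mem_Icc.1 (hm y hy)).1, hyx⟩⟩
    · rwa [offDiag_pair, nsmul_eq_mul] at h
  · rintro ⟨x, y⟩ - -
    rw [offDiag_pair, nsmul_eq_mul, numPairs]

end Pairs

section States

/-- `m` is a state of total mass `n` from which `j` jumps remain. -/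
structure IsState (n j : ℕ) (m : Multiset ℕ) : Prop where
  card_eq : m.card = j + 1
  sum_eq : m.sum = n
  pos : ∀ x ∈ m, 1 ≤ x

/-- The power sum of order `k` of the relative sizes `x / n` of the clusters. -/
def relSum (n k : ℕ) (m : Multiset ℕ) : ℝ := (m.map fun x : ℕ => ((x : ℝ) / n) ^ k).sum

lemma isState_replicate {n : ℕ} (hn : 1 ≤ n) : IsState n (n - 1) (Multiset.replicate n 1) where
  card_eq := by rw [Multiset.card_replicate, Nat.sub_add_cancel hn]
  sum_eq := by simp
  pos _ hx := (Multiset.eq_of_mem_replicate hx).ge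

lemma relSum_replicate (n k : ℕ) :
    relSum n k (Multiset.replicate n 1) = n * (1 / n) ^ k := by
  simp [relSum]

lemma relSum_nonneg (n k : ℕ) (m : Multiset ℕ) : 0 ≤ relSum n k m :=
  Multiset.sum_nonneg fun z hz => by
    obtain ⟨x, -, rfl⟩ := Multiset.mem_map.1 hz
    positivity

lemma relSum_three_le (n : ℕ) (m : Multiset ℕ) :
    relSum n 3 m ≤ √(relSum n 2 m) * relSum n 2 m := by
  have hle : ∀ x ∈ m, (x : ℝ) / n ≤ √(relSum n 2 m) := fun x hx => by
    refine Real.le_sqrt_of_sq_le (Multiset.single_le_sum (fun z hz => ?_) _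
      (Multiset.mem_map.2 ⟨x, hx, rfl⟩))
    obtain ⟨y, -, rfl⟩ := Multiset.mem_map.1 hz
    positivity
  rw [relSum, relSum, ← Multiset.sum_map_mul_left]
  refine Multiset.sum_map_le_sum_map _ _ fun x hx => ?_
  rw [pow_succ' _ 2]
  exact mul_le_mul_of_nonneg_right (hle x hx) (sq_nonneg _)

section Merge

variable {m : Multiset ℕ} {x y : ℕ} (hxy : {x, y} ≤ m)

include hxy

lemma IsState.merge {n j : ℕ} (h : IsState n (j + 1) m) : IsState n j (merge m x y) := by
  obtain ⟨r, rfl⟩ := Multiset.le_iff_exists_add.1 hxy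
  obtain ⟨hcard, hsum, hpos⟩ := h
  rw [MarcusLushnikov.merge, add_tsub_cancel_left]
  simp only [Multiset.card_add, Multiset.card_pair, Multiset.sum_add, Multiset.sum_pair]
    at hcard hsum
  refine ⟨?_, ?_, fun z hz => ?_⟩
  · rw [Multiset.card_add, Multiset.card_singleton]
    omega
  · rw [Multiset.sum_add, Multiset.sum_singleton]
    omega
  · obtain hz | hz := Multiset.mem_add.1 hz
    · exact hpos z (Multiset.mem_add.2 (Or.inr hz))
    · rw [Multiset.mem_singleton.1 hz]
      exact (hpos x (by simp)).trans (Nat.le_add_right x y)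

lemma relSum_two_merge (n : ℕ) :
    relSum n 2 (MarcusLushnikov.merge m x y) = relSum n 2 m + 2 * (x / n * (y / n)) := by
  obtain ⟨r, rfl⟩ := Multiset.le_iff_exists_add.1 hxy
  rw [MarcusLushnikov.merge, add_tsub_cancel_left]
  simp only [relSum, Multiset.map_add, Multiset.sum_add, Multiset.insert_eq_cons,
    Multiset.map_cons, Multiset.map_singleton, Multiset.sum_cons, Multiset.sum_singleton,
    Nat.cast_add]
  ring

lemma sq_add_sq_le_relSum_two (n : ℕ) : (x / n : ℝ) ^ 2 + (y / n : ℝ) ^ 2 ≤ relSum n 2 m := by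
  obtain ⟨r, rfl⟩ := Multiset.le_iff_exists_add.1 hxy
  have hr := relSum_nonneg n 2 r
  simp only [relSum, Multiset.map_add, Multiset.sum_add, Multiset.insert_eq_cons,
    Multiset.map_cons, Multiset.map_singleton, Multiset.sum_cons, Multiset.sum_singleton] at hr ⊢
  linarith

end Merge

namespace IsState

variable {n j : ℕ} {m : Multiset ℕ} (h : IsState n j m)

include h

lemma mem_Icc {x : ℕ} (hx : x ∈ m) : x ∈ Finset.Icc 1 n :=
  Finset.mem_Icc.2 ⟨h.pos x hx, h.sum_eq ▸ Multiset.le_sum_of_mem hx⟩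

lemma relSum_zero : relSum n 0 m = j + 1 := by
  simp [relSum, h.card_eq, add_comm]

lemma exists_mem : ∃ x, x ∈ m :=
  Multiset.card_pos_iff_exists_mem.1 (h.card_eq.symm ▸ j.succ_pos)

lemma mass_pos : (0 : ℝ) < n := by
  obtain ⟨x, hx⟩ := h.exists_mem
  obtain ⟨hx₁, hxn⟩ := Finset.mem_Icc.1 (h.mem_Icc hx)
  exact Nat.cast_pos.2 (hx₁.trans hxn)

lemma relSum_one : relSum n 1 m = 1 := by
  simp only [relSum, pow_one, Multiset.sum_map_div]
  rw [← Nat.cast_multiset_sum, h.sum_eq, div_self h.mass_pos.ne']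

lemma relSum_two_pos : 0 < relSum n 2 m := by
  obtain ⟨x, hx⟩ := h.exists_mem
  have hn := h.mass_pos
  have hx₀ : (0 : ℝ) < x := Nat.cast_pos.2 (h.pos x hx)
  refine lt_of_lt_of_le (b := (x / n : ℝ) ^ 2) (by positivity)
    (Multiset.single_le_sum (fun z hz => ?_) _ (Multiset.mem_map.2 ⟨x, hx, rfl⟩))
  obtain ⟨y, -, rfl⟩ := Multiset.mem_map.1 hz
  positivity

lemma relSum_two_le_one : relSum n 2 m ≤ 1 := by
  rw [← h.relSum_one]
  refine Multiset.sum_map_le_sum_map _ _ fun x hx => ?_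
  refine pow_le_pow_of_le_one (by positivity) ?_ one_le_two
  exact div_le_one_of_le₀ (Nat.cast_le.2 (Finset.mem_Icc.1 (h.mem_Icc hx)).2) n.cast_nonneg

lemma totalRate_additiveKernel : totalRate additiveKernel n m = j := by
  have hsplit : ∀ x y : ℕ, additiveKernel x y / n = x / n * 1 + y / n * 1 := fun x y => by
    rw [additiveKernel]
    ring
  have hone : (m.map fun x : ℕ => (x : ℝ) / n).sum = 1 := by
    simpa only [relSum, pow_one] using h.relSum_one
  simp only [totalRate, jumpRate, hsplit]
  rw [sum_numPairs_mul (fun _ => h.mem_Icc) fun x _ => x / n * 1,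
    offDiag_mul m (fun x : ℕ => (x : ℝ) / n) fun _ => 1]
  simp [hone, h.card_eq]

end IsState

end States

section OneJump

/-- The probability that the next jump merges clusters of sizes `a.1` and `a.2`. -/
def pairWeight (K : ℕ → ℕ → ℝ) (n : ℕ) (m : Multiset ℕ) (a : ℕ × ℕ) : ℝ :=
  jumpRate K n m a.1 a.2 / totalRate K n m

/-- The probability that the next jump of the additive process merges clusters of sizes `a.1.1`
and `a.1.2`, and that the size-biased pick has size `a.2`. -/
def pickWeight (n : ℕ) (m : Multiset ℕ) (a : (ℕ × ℕ) × ℕ) : ℝ :=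
  pairWeight additiveKernel n m a.1 * sizeBiased a.1.1 a.1.2 a.2

/-- The pairs of sizes, the larger one first, of the clusters that may merge. -/
def pairSupport (n : ℕ) : Finset (ℕ × ℕ) :=
  {a ∈ Finset.Icc 1 n ×ˢ Finset.Icc 1 n | a.2 ≤ a.1}

/-- The pairs of sizes of the clusters that may merge, with the size of the pick. -/
def pickSupport (n : ℕ) : Finset ((ℕ × ℕ) × ℕ) := pairSupport n ×ˢ Finset.Icc 1 n

/-- The relative size of the picked cluster. -/
def pick (n : ℕ) (a : (ℕ × ℕ) × ℕ) : ℝ := a.2 / n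

/-- The relative size of the other cluster, the one that is not picked. -/
def prey (n : ℕ) (a : (ℕ × ℕ) × ℕ) : ℝ := (a.1.1 + a.1.2 - a.2) / n

/-- The expectation of `φ` over the next jump of the additive process in the state `m`, together
with its size-biased pick. -/
def jumpMean (n : ℕ) (m : Multiset ℕ) (φ : (ℕ × ℕ) × ℕ → ℝ) : ℝ :=
  ∑ a ∈ pickSupport n, pickWeight n m a * φ a

lemma mem_pairSupport {n : ℕ} (a : ℕ × ℕ) :
    a ∈ pairSupport n ↔ a.1 ∈ Finset.Icc 1 n ∧ a.2 ∈ Finset.Icc 1 a.1 := by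
  simp only [pairSupport, Finset.mem_filter, Finset.mem_product, Finset.mem_Icc]
  omega

lemma totalRate_eq_sum_pairSupport (K : ℕ → ℕ → ℝ) (n : ℕ) (m : Multiset ℕ) :
    totalRate K n m = ∑ a ∈ pairSupport n, jumpRate K n m a.1 a.2 := by
  rw [Finset.sum_finset_product _ _ _ mem_pairSupport, totalRate]

lemma sum_pairWeight {K : ℕ → ℕ → ℝ} {n : ℕ} {m : Multiset ℕ} (h : totalRate K n m ≠ 0) :
    ∑ a ∈ pairSupport n, pairWeight K n m a = 1 := by
  simp only [pairWeight]
  rw [← Finset.sum_div, ← totalRate_eq_sum_pairSupport, div_self h]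

lemma pair_le_of_pairWeight_ne_zero {K : ℕ → ℕ → ℝ} {n : ℕ} {m : Multiset ℕ} {a : ℕ × ℕ}
    (h : pairWeight K n m a ≠ 0) : {a.1, a.2} ≤ m := by
  have hcount : numPairs m a.1 a.2 ≠ 0 := fun h₀ => h (by simp [pairWeight, jumpRate, h₀])
  exact (Multiset.mem_powersetCard.1 (Multiset.count_ne_zero.1 hcount)).1

lemma pairWeight_additiveKernel_nonneg (n : ℕ) (m : Multiset ℕ) (a : ℕ × ℕ) :
    0 ≤ pairWeight additiveKernel n m a := by
  have hrate : ∀ x y, 0 ≤ jumpRate additiveKernel n m x y := fun x y => by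
    rw [jumpRate, additiveKernel]
    positivity
  exact div_nonneg (hrate _ _) (Finset.sum_nonneg fun x _ => Finset.sum_nonneg fun y _ => hrate x y)

lemma sizeBiased_nonneg (x y l : ℕ) : 0 ≤ sizeBiased x y l := by
  rw [sizeBiased]
  split_ifs <;> positivity

lemma pickWeight_nonneg (n : ℕ) (m : Multiset ℕ) (a : (ℕ × ℕ) × ℕ) : 0 ≤ pickWeight n m a :=
  mul_nonneg (pairWeight_additiveKernel_nonneg _ _ _) (sizeBiased_nonneg _ _ _)

lemma add_mul_sum_sizeBiased_mul {n x y : ℕ} (hx : x ∈ Finset.Icc 1 n) (hy : y ∈ Finset.Icc 1 n)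
    (G : ℕ → ℝ) :
    (x + y : ℝ) * ∑ l ∈ Finset.Icc 1 n, sizeBiased x y l * G l = x * G x + y * G y := by
  have hxy : (x : ℝ) + y ≠ 0 := by
    have := (Finset.mem_Icc.1 hx).1
    positivity
  simp only [sizeBiased, add_mul, ite_mul, zero_mul, Finset.sum_add_distrib, Finset.sum_ite_eq',
    hx, hy, if_true]
  field_simp

/- The size bias turns the additive rate into a sum over ordered pairs: the pick is a
size-biased cluster, and the prey is uniform among the others. -/
lemma IsState.jumpMean_pick_prey {n j : ℕ} {m : Multiset ℕ} (h : IsState n j m)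
    (H : ℝ → ℝ → ℝ) :
    jumpMean n m (fun a => H (pick n a) (prey n a)) =
      offDiag m (fun x y => x / n * H (x / n) (y / n)) / j := by
  rw [jumpMean, pickSupport, Finset.sum_product, ← sum_numPairs_mul fun _ => h.mem_Icc,
    Finset.sum_finset_product _ _ _ mem_pairSupport, Finset.sum_div]
  refine Finset.sum_congr rfl fun x hx => ?_
  rw [Finset.sum_div]
  refine Finset.sum_congr rfl fun y hy => ?_
  have hy' : y ∈ Finset.Icc 1 n := by
    rw [Finset.mem_Icc] at hx hy ⊢
    omega
  have hpick := add_mul_sum_sizeBiased_mul hx hy' fun l =>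
    H (pick n ((x, y), l)) (prey n ((x, y), l))
  simp only [pick, prey, add_sub_cancel_left, add_sub_cancel_right] at hpick
  simp only [pickWeight, pairWeight, jumpRate, additiveKernel, h.totalRate_additiveKernel,
    pick, prey, mul_assoc, ← Finset.mul_sum]
  have hassoc : ∀ c S : ℝ, numPairs m x y * ((x + y : ℝ) / n) / c * S =
      numPairs m x y * ((x + y : ℝ) * S / n) / c := fun c S => by ring
  rw [hassoc, hpick]
  ring

lemma IsState.jumpMean_pick_pow_mul_prey_pow {n j : ℕ} {m : Multiset ℕ} (h : IsState n j m)
    (i k : ℕ) :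
    jumpMean n m (fun a => pick n a ^ i * prey n a ^ k) =
      (relSum n (i + 1) m * relSum n k m - relSum n (i + 1 + k) m) / j := by
  rw [h.jumpMean_pick_prey fun u v => u ^ i * v ^ k]
  simp only [← mul_assoc, ← pow_succ']
  rw [offDiag_mul m (fun x : ℕ => ((x : ℝ) / n) ^ (i + 1)) fun y : ℕ => ((y : ℝ) / n) ^ k]
  simp only [relSum, pow_add]

lemma isFiniteChain_pairWeight (n : ℕ) :
    IsFiniteChain (pairWeight additiveKernel n) (fun m a => merge m a.1 a.2) (pairSupport n)
      (IsState n) where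
  nonneg := pairWeight_additiveKernel_nonneg n
  sum_eq_one h := sum_pairWeight (by rw [h.totalRate_additiveKernel]; positivity)
  step h hw := h.merge (pair_le_of_pairWeight_ne_zero hw)

lemma isFiniteChain_pickWeight (n : ℕ) :
    IsFiniteChain (pickWeight n) (fun m a => merge m a.1.1 a.1.2) (pickSupport n)
      (IsState n) where
  nonneg := pickWeight_nonneg n
  sum_eq_one {j m} h := by
    have key := h.jumpMean_pick_pow_mul_prey_pow 0 0
    simp only [jumpMean, pow_zero, mul_one, zero_add, add_zero, h.relSum_zero, h.relSum_one,
      Nat.cast_add, Nat.cast_one, one_mul, add_sub_cancel_right] at key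
    rw [key, div_self (by positivity)]
  step h hw := h.merge (pair_le_of_pairWeight_ne_zero (left_ne_zero_of_mul hw))

lemma pick_mul_prey_of_pickWeight_ne_zero {n : ℕ} {m : Multiset ℕ} {a : (ℕ × ℕ) × ℕ}
    (h : pickWeight n m a ≠ 0) : pick n a * prey n a = a.1.1 / n * (a.1.2 / n) := by
  have hpick : a.2 = a.1.1 ∨ a.2 = a.1.2 := by
    by_contra! hne
    exact h (by simp [pickWeight, sizeBiased, hne.1, hne.2])
  rw [pick, prey]
  obtain h₂ | h₂ := hpick <;> rw [h₂] <;> ring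

lemma relSum_two_merge_of_pickWeight_ne_zero {n : ℕ} {m : Multiset ℕ} {a : (ℕ × ℕ) × ℕ}
    (h : pickWeight n m a ≠ 0) :
    relSum n 2 (merge m a.1.1 a.1.2) = relSum n 2 m + 2 * (pick n a * prey n a) := by
  rw [relSum_two_merge (pair_le_of_pairWeight_ne_zero (left_ne_zero_of_mul h)),
    pick_mul_prey_of_pickWeight_ne_zero h]

lemma two_mul_pick_mul_prey_mem_Icc {n : ℕ} {m : Multiset ℕ} {a : (ℕ × ℕ) × ℕ}
    (h : pickWeight n m a ≠ 0) : 2 * (pick n a * prey n a) ∈ Set.Icc 0 (relSum n 2 m) := by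
  have hle := sq_add_sq_le_relSum_two (pair_le_of_pairWeight_ne_zero (left_ne_zero_of_mul h)) n
  rw [pick_mul_prey_of_pickWeight_ne_zero h]
  exact ⟨by positivity, by nlinarith [sq_nonneg ((a.1.1 : ℝ) / n - a.1.2 / n)]⟩

section JumpMean

variable {n : ℕ} {m : Multiset ℕ} {φ ψ : (ℕ × ℕ) × ℕ → ℝ}

lemma jumpMean_mono (h : ∀ a, pickWeight n m a ≠ 0 → φ a ≤ ψ a) :
    jumpMean n m φ ≤ jumpMean n m ψ := by
  refine Finset.sum_le_sum fun a _ => ?_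
  obtain hw | hw := eq_or_ne (pickWeight n m a) 0
  · simp [hw]
  · exact mul_le_mul_of_nonneg_left (h a hw) (pickWeight_nonneg n m a)

lemma jumpMean_congr (h : ∀ a, pickWeight n m a ≠ 0 → φ a = ψ a) :
    jumpMean n m φ = jumpMean n m ψ :=
  (jumpMean_mono fun a ha => (h a ha).le).antisymm (jumpMean_mono fun a ha => (h a ha).ge)

lemma jumpMean_add (n : ℕ) (m : Multiset ℕ) (φ ψ : (ℕ × ℕ) × ℕ → ℝ) :
    jumpMean n m (fun a => φ a + ψ a) = jumpMean n m φ + jumpMean n m ψ := by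
  simp only [jumpMean, mul_add, Finset.sum_add_distrib]

lemma jumpMean_const_mul (n : ℕ) (m : Multiset ℕ) (c : ℝ) (φ : (ℕ × ℕ) × ℕ → ℝ) :
    jumpMean n m (fun a => c * φ a) = c * jumpMean n m φ := by
  simp only [jumpMean, Finset.mul_sum, mul_left_comm]

lemma IsState.jumpMean_const {j : ℕ} (h : IsState n (j + 1) m) (c : ℝ) :
    jumpMean n m (fun _ => c) = c := by
  rw [jumpMean, ← Finset.sum_mul, (isFiniteChain_pickWeight n).sum_eq_one h, one_mul]

end JumpMean

end OneJump

section Drift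

namespace IsState

variable {n j : ℕ} {m : Multiset ℕ} (h : IsState n (j + 1) m)

include h

lemma jumpMean_prey : jumpMean n m (prey n) = (1 - relSum n 2 m) / (j + 1) := by
  simpa [h.relSum_one] using h.jumpMean_pick_pow_mul_prey_pow 0 1

lemma jumpMean_prey_sq :
    jumpMean n m (fun a => prey n a ^ 2) = (relSum n 2 m - relSum n 3 m) / (j + 1) := by
  simpa [h.relSum_one] using h.jumpMean_pick_pow_mul_prey_pow 0 2

lemma jumpMean_pick_mul_prey :
    jumpMean n m (fun a => pick n a * prey n a) = (relSum n 2 m - relSum n 3 m) / (j + 1) := by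
  simpa [h.relSum_one] using h.jumpMean_pick_pow_mul_prey_pow 1 1

lemma jumpMean_pick_mul_prey_sq_le :
    jumpMean n m (fun a => (pick n a * prey n a) ^ 2) ≤
      √(relSum n 2 m) * relSum n 2 m ^ 2 / (j + 1) := by
  have key := h.jumpMean_pick_pow_mul_prey_pow 2 2
  simp only [← mul_pow, Nat.cast_add, Nat.cast_one] at key
  rw [key, pow_two (relSum n 2 m), ← mul_assoc]
  gcongr
  refine (sub_le_self _ (relSum_nonneg n _ m)).trans ?_
  exact mul_le_mul_of_nonneg_right (relSum_three_le n m) (relSum_nonneg n 2 m)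

lemma jumpMean_relSum_two_merge :
    jumpMean n m (fun a => relSum n 2 (MarcusLushnikov.merge m a.1.1 a.1.2)) =
      relSum n 2 m + 2 * ((relSum n 2 m - relSum n 3 m) / (j + 1)) := by
  rw [jumpMean_congr fun a ha => relSum_two_merge_of_pickWeight_ne_zero ha, jumpMean_add,
    h.jumpMean_const, jumpMean_const_mul, h.jumpMean_pick_mul_prey]

lemma jumpMean_relSum_two_merge_le :
    jumpMean n m (fun a => relSum n 2 (MarcusLushnikov.merge m a.1.1 a.1.2)) ≤
      relSum n 2 m + 2 * (relSum n 2 m / (j + 1)) := by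
  rw [h.jumpMean_relSum_two_merge]
  gcongr
  exact sub_le_self _ (relSum_nonneg n 3 m)

lemma jumpMean_prey_sq_add :
    jumpMean n m (fun a => prey n a ^ 2) +
      jumpMean n m (fun a => (1 - relSum n 2 (MarcusLushnikov.merge m a.1.1 a.1.2)) / 2) =
      (1 - relSum n 2 m) / 2 := by
  have hlin : ∀ a : (ℕ × ℕ) × ℕ, (1 - relSum n 2 (MarcusLushnikov.merge m a.1.1 a.1.2)) / 2 =
      1 / 2 + -(1 / 2) * relSum n 2 (MarcusLushnikov.merge m a.1.1 a.1.2) := fun a => by ring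
  simp only [hlin]
  rw [jumpMean_add, h.jumpMean_const, jumpMean_const_mul, h.jumpMean_relSum_two_merge,
    h.jumpMean_prey_sq]
  ring

/- A jump multiplies the sum of squares `q` by `1 + x` with `x = 2 * pick * prey / q ∈ [0, 1]`. -/
lemma log_relSum_two_add_le {α β : ℝ} (hα : 0 ≤ α) (hβ : 0 ≤ β)
    (hlog : ∀ x ∈ Set.Icc (0 : ℝ) 1, α * x - β * x ^ 2 ≤ Real.log (1 + x)) :
    Real.log (relSum n 2 m) +
        (2 * α * (1 - √(relSum n 2 m)) - 4 * β * √(relSum n 2 m)) / (j + 1) ≤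
      jumpMean n m (fun a => Real.log (relSum n 2 (MarcusLushnikov.merge m a.1.1 a.1.2))) := by
  set q := relSum n 2 m
  have hq : 0 < q := h.relSum_two_pos
  have hfirst : (1 - √q) / (j + 1) ≤ jumpMean n m (fun a => pick n a * prey n a) / q := by
    rw [h.jumpMean_pick_mul_prey, le_div_iff₀ hq, div_mul_eq_mul_div]
    gcongr
    linarith [relSum_three_le n m]
  have hsecond : jumpMean n m (fun a => (pick n a * prey n a) ^ 2) / q ^ 2 ≤ √q / (j + 1) := by
    rw [div_le_iff₀ (by positivity), div_mul_eq_mul_div]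
    exact h.jumpMean_pick_mul_prey_sq_le
  calc _ = Real.log q + (2 * α * ((1 - √q) / (j + 1)) - 4 * β * (√q / (j + 1))) := by ring
    _ ≤ Real.log q + (2 * α * (jumpMean n m (fun a => pick n a * prey n a) / q) -
          4 * β * (jumpMean n m (fun a => (pick n a * prey n a) ^ 2) / q ^ 2)) := by gcongr
    _ = jumpMean n m (fun a => Real.log q + (2 * α / q * (pick n a * prey n a) +
          -(4 * β / q ^ 2) * (pick n a * prey n a) ^ 2)) := by
        rw [jumpMean_add, h.jumpMean_const, jumpMean_add, jumpMean_const_mul, jumpMean_const_mul]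
        ring
    _ ≤ _ := jumpMean_mono fun a ha => by
        obtain ⟨h₀, h₁⟩ := two_mul_pick_mul_prey_mem_Icc ha
        have hx : 2 * (pick n a * prey n a) / q ∈ Set.Icc (0 : ℝ) 1 :=
          ⟨div_nonneg h₀ hq.le, div_le_one_of_le₀ h₁ hq.le⟩
        have hmerge : relSum n 2 (MarcusLushnikov.merge m a.1.1 a.1.2) =
            q * (1 + 2 * (pick n a * prey n a) / q) := by
          rw [relSum_two_merge_of_pickWeight_ne_zero ha, mul_add, mul_one,
            mul_div_cancel₀ _ hq.ne']
        rw [hmerge, Real.log_mul hq.ne' (by linarith [hx.1])]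
        refine add_le_add_right (le_of_eq_of_le ?_ (hlog _ hx)) _
        ring

end IsState

end Drift

section Potential

/-- The approximate mean of the relative prey size when `j + 1` jumps remain: the exact mean
is `(1 - q) / (j + 1)`, for `q` the sum of the squares of the relative cluster sizes, and `q` is
small as long as more than `r` jumps remain. -/
def target (r j : ℕ) : ℝ := if r ≤ j then 1 / (j + 1) else 0

/-- The coefficient of the sum of squares in `potential`. It solves the recursion
`slope_succ_of_le`, and the truncated subtraction makes it vanish for `j ≤ r`. -/
def slope (r j : ℕ) : ℝ := 5 * (j + 1) * (j - r : ℕ) / ((r + 1) * (r + 2))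

/-- The deterministic part of `potential`; the terms `4 / (i + 1)` account for the growth of the
logarithm of the sum of squares while more than `r` jumps remain. -/
def offset (r j : ℕ) : ℝ := ∑ i ∈ Finset.Ico r j, (4 * (r + 1) / (i + 1) ^ 2 - 4 / (i + 1))

/-- A Lyapunov function: its mean decreases at each jump by at least the distance of the mean
relative prey size from `target`. -/
def potential (n r j : ℕ) (m : Multiset ℕ) : ℝ :=
  -2 * Real.log (relSum n 2 m) + slope r j * relSum n 2 m + offset r j

lemma slope_nonneg (r j : ℕ) : 0 ≤ slope r j := by
  rw [slope]
  positivity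

lemma slope_of_le {r j : ℕ} (h : j ≤ r) : slope r j = 0 := by
  simp [slope, Nat.sub_eq_zero_of_le h]

lemma offset_of_le {r j : ℕ} (h : j ≤ r) : offset r j = 0 := by
  simp [offset, Finset.Ico_eq_empty_of_le h]

lemma slope_succ_of_le {r j : ℕ} (h : r ≤ j) :
    slope r (j + 1) = slope r j * (1 + 2 / (j + 1)) + 5 / (r + 1) := by
  rw [slope, slope, Nat.cast_sub h, Nat.cast_sub (h.trans j.le_succ)]
  push_cast
  field_simp
  ring

lemma offset_succ_of_le {r j : ℕ} (h : r ≤ j) :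
    offset r (j + 1) = offset r j + (4 * (r + 1) / (j + 1) ^ 2 - 4 / (j + 1)) :=
  Finset.sum_Ico_succ_top h _

lemma half_mul_le_log_one_add {x : ℝ} (hx : x ∈ Set.Icc 0 1) : x / 2 ≤ Real.log (1 + x) := by
  refine le_trans ?_ (Real.le_log_one_add_of_nonneg hx.1)
  rw [div_le_div_iff₀ two_pos (by linarith [hx.1])]
  nlinarith [hx.1, hx.2]

lemma sub_sq_div_two_le_log_one_add {x : ℝ} (hx : 0 ≤ x) : x - x ^ 2 / 2 ≤ Real.log (1 + x) := by
  refine le_trans ?_ (Real.le_log_one_add_of_nonneg hx)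
  rw [le_div_iff₀ (by linarith)]
  nlinarith [pow_nonneg hx 3]

lemma eight_mul_sqrt_div_le (r j : ℕ) {q : ℝ} (hq : 0 ≤ q) :
    8 * √q / (j + 1) ≤ 4 * q / (r + 1) + 4 * (r + 1) / (j + 1) ^ 2 := by
  have hsq : 4 * q / (r + 1) + 4 * (r + 1) / (j + 1 : ℝ) ^ 2 - 8 * √q / (j + 1) =
      4 / (r + 1) * (√q - (r + 1) / (j + 1)) ^ 2 := by
    rw [sub_sq, Real.sq_sqrt hq]
    field_simp
    ring
  exact sub_nonneg.1 (hsq ▸ by positivity)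

namespace IsState

variable {n j : ℕ} {m : Multiset ℕ}

lemma potential_zero_nonneg (h : IsState n 0 m) (r : ℕ) : 0 ≤ potential n r 0 m := by
  rw [potential, slope_of_le r.zero_le, offset_of_le r.zero_le]
  linarith [Real.log_nonpos h.relSum_two_pos.le h.relSum_two_le_one]

variable (h : IsState n (j + 1) m)

include h

lemma abs_jumpMean_prey_sub_target_of_le {r : ℕ} (hr : r ≤ j) :
    |jumpMean n m (prey n) - target r j| = relSum n 2 m / (j + 1) := by
  rw [h.jumpMean_prey, target, if_pos hr, ← sub_div, sub_sub_cancel_left, neg_div, abs_neg,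
    abs_of_nonneg (div_nonneg h.relSum_two_pos.le (by positivity))]

lemma abs_jumpMean_prey_sub_target_of_lt {r : ℕ} (hr : j < r) :
    |jumpMean n m (prey n) - target r j| = (1 - relSum n 2 m) / (j + 1) := by
  rw [h.jumpMean_prey, target, if_neg hr.not_ge, sub_zero,
    abs_of_nonneg (div_nonneg (sub_nonneg.2 h.relSum_two_le_one) (by positivity))]

lemma abs_jumpMean_prey_sub_target_le (r : ℕ) :
    |jumpMean n m (prey n) - target r j| ≤ 1 / (j + 1) := by
  obtain hr | hr := le_or_gt r j
  · rw [h.abs_jumpMean_prey_sub_target_of_le hr]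
    gcongr
    exact h.relSum_two_le_one
  · rw [h.abs_jumpMean_prey_sub_target_of_lt hr]
    gcongr
    linarith [h.relSum_two_pos]

lemma jumpMean_potential_merge (r : ℕ) :
    jumpMean n m (fun a => potential n r j (MarcusLushnikov.merge m a.1.1 a.1.2)) =
      -2 * jumpMean n m
          (fun a => Real.log (relSum n 2 (MarcusLushnikov.merge m a.1.1 a.1.2))) +
        slope r j *
          jumpMean n m (fun a => relSum n 2 (MarcusLushnikov.merge m a.1.1 a.1.2)) +
        offset r j := by
  simp only [potential]
  rw [jumpMean_add, jumpMean_add, jumpMean_const_mul, jumpMean_const_mul, h.jumpMean_const]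

lemma potential_drift_of_lt {r : ℕ} (hr : j < r) :
    |jumpMean n m (prey n) - target r j| +
        jumpMean n m (fun a => potential n r j (MarcusLushnikov.merge m a.1.1 a.1.2)) ≤
      potential n r (j + 1) m := by
  rw [h.abs_jumpMean_prey_sub_target_of_lt hr, h.jumpMean_potential_merge, potential,
    slope_of_le hr, slope_of_le hr.le, offset_of_le hr, offset_of_le hr.le]
  set q := relSum n 2 m
  have hlog := h.log_relSum_two_add_le (α := 1 / 2) (β := 0) (by norm_num) le_rfl fun x hx => by
    linarith [half_mul_le_log_one_add hx]
  have hsqrt : (1 - q) / (j + 1) ≤ 2 * ((1 - √q) / (j + 1)) := by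
    rw [← mul_div_assoc]
    gcongr
    nlinarith [Real.sq_sqrt h.relSum_two_pos.le, sq_nonneg (1 - √q)]
  simp only [div_eq_mul_inv] at *
  linarith

lemma potential_drift_of_le {r : ℕ} (hr : r ≤ j) :
    |jumpMean n m (prey n) - target r j| +
        jumpMean n m (fun a => potential n r j (MarcusLushnikov.merge m a.1.1 a.1.2)) ≤
      potential n r (j + 1) m := by
  rw [h.abs_jumpMean_prey_sub_target_of_le hr, h.jumpMean_potential_merge, potential,
    slope_succ_of_le hr, offset_succ_of_le hr]
  set q := relSum n 2 m
  have hq₀ : 0 ≤ q := h.relSum_two_pos.le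
  have hlog := h.log_relSum_two_add_le (α := 1) (β := 1 / 2) zero_le_one (by norm_num)
    fun x hx => by linarith [sub_sq_div_two_le_log_one_add hx.1]
  have hquad := mul_le_mul_of_nonneg_left h.jumpMean_relSum_two_merge_le (slope_nonneg r j)
  have hmean : q / (j + 1) ≤ q / (r + 1) := by gcongr
  have hamgm := eight_mul_sqrt_div_le r j hq₀
  simp only [div_eq_mul_inv] at *
  linarith

lemma potential_drift (r : ℕ) :
    |jumpMean n m (prey n) - target r j| +
        jumpMean n m (fun a => potential n r j (MarcusLushnikov.merge m a.1.1 a.1.2)) ≤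
      potential n r (j + 1) m :=
  (le_or_gt r j).elim h.potential_drift_of_le h.potential_drift_of_lt

end IsState

lemma IsState.pathSum_prey_sq_le {n j : ℕ} {m : Multiset ℕ} (h : IsState n j m) (r : ℕ)
    {d H : ℝ} (hH₀ : 0 ≤ H) (hH : |d| + ∑ i ∈ Finset.range j, 1 / ((i : ℝ) + 1) ≤ H) :
    pathSum (pickWeight n) (fun m a => MarcusLushnikov.merge m a.1.1 a.1.2) (pickSupport n)
        (fun p : Fin j → (ℕ × ℕ) × ℕ =>
          (d + ∑ i, prey n (p i) - ∑ i ∈ Finset.range j, target r i) ^ 2) m ≤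
      1 - relSum n 2 m + 2 * H * (|d| + potential n r j m) := by
  have key := (isFiniteChain_pickWeight n).pathSum_sq_le (X := prey n) (t := target r)
    (u := fun i => 1 / ((i : ℝ) + 1)) (V := fun _ m => (1 - relSum n 2 m) / 2)
    (U := potential n r) (fun h => by linarith [h.relSum_two_le_one])
    (fun h => h.potential_zero_nonneg r) (fun h => h.jumpMean_prey_sq_add.le)
    (fun h => h.potential_drift r) (fun h => h.abs_jumpMean_prey_sub_target_le r) h (z := 0) hH₀ hH
  simp only [zero_add] at key
  linarith

end Potential

section Law

variable {Ω : Type*} [MeasurableSpace Ω] {P : Measure Ω}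

section Finite

variable {β : Type*} [MeasurableSpace β] [MeasurableSingletonClass β] {Y : Ω → β} {T : Finset β}
  {v : β → ℝ}

lemma measureReal_preimage_singleton_eq_of_le [IsProbabilityMeasure P] (hY : Measurable Y)
    (hle : ∀ p ∈ T, v p ≤ P.real (Y ⁻¹' {p})) (hv : ∑ p ∈ T, v p = 1) {p : β} (hp : p ∈ T) :
    P.real (Y ⁻¹' {p}) = v p := by
  have htotal : ∑ p ∈ T, P.real (Y ⁻¹' {p}) ≤ ∑ p ∈ T, v p := by
    rw [sum_measureReal_preimage_singleton T fun p _ => hY (measurableSet_singleton p), hv]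
    exact measureReal_le_one
  exact ((Finset.sum_eq_sum_iff_of_le hle).1 ((Finset.sum_le_sum hle).antisymm htotal) p hp).symm

lemma lintegral_ofReal_comp_eq_sum [Countable β] [IsProbabilityMeasure P] (hY : Measurable Y)
    (hlaw : ∀ p ∈ T, P.real (Y ⁻¹' {p}) = v p) (hv : ∑ p ∈ T, v p = 1) {F : β → ℝ}
    (hF : ∀ p, 0 ≤ F p) :
    ∫⁻ ω, ENNReal.ofReal (F (Y ω)) ∂P = ENNReal.ofReal (∑ p ∈ T, v p * F p) := by
  have hmap : ∀ p, P.map Y {p} = P (Y ⁻¹' {p}) := fun p =>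
    Measure.map_apply hY (measurableSet_singleton p)
  have hT : (T : Set β) =ᵐ[P.map Y] Set.univ := by
    have := Measure.isProbabilityMeasure_map hY.aemeasurable (μ := P)
    rw [ae_eq_univ, prob_compl_eq_zero_iff T.measurableSet,
      Measure.map_apply hY T.measurableSet, ← ofReal_measureReal,
      ← sum_measureReal_preimage_singleton T fun p _ => hY (measurableSet_singleton p),
      Finset.sum_congr rfl hlaw, hv, ENNReal.ofReal_one]
  calc ∫⁻ ω, ENNReal.ofReal (F (Y ω)) ∂P
      = ∫⁻ p in (T : Set β), ENNReal.ofReal (F p) ∂P.map Y := by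
        rw [setLIntegral_congr hT, setLIntegral_univ,
          lintegral_map (measurable_of_countable _) hY]
    _ = ∑ p ∈ T, ENNReal.ofReal (v p * F p) := by
        rw [lintegral_finset]
        refine Finset.sum_congr rfl fun p hp => ?_
        rw [hmap, mul_comm (v p), ENNReal.ofReal_mul (hF p), ← hlaw p hp, ofReal_measureReal]
    _ = ENNReal.ofReal (∑ p ∈ T, v p * F p) := by
        refine (ENNReal.ofReal_sum_of_nonneg fun p hp => mul_nonneg ?_ (hF p)).symm
        exact hlaw p hp ▸ measureReal_nonneg

end Finite

lemma traj_merge {β : Type*} (x y : β → ℕ) (n : ℕ) (a : ℕ → β) (k : ℕ) :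
    traj (fun m b => merge m (x b) (y b)) (Multiset.replicate n 1) a k =
      clusters n (fun i => x (a i)) (fun i => y (a i)) k := by
  induction k with
  | zero => rfl
  | succ k ih => rw [traj, ih, clusters]

lemma exists_extension_of_forall_fin {α : Type*} {Q : α → Prop} (hQ : ∃ b, Q b) {j : ℕ}
    {p : Fin j → α} (hp : ∀ i, Q (p i)) :
    ∃ a : ℕ → α, (∀ k, Q (a k)) ∧ p = fun i : Fin j => a i := by
  obtain ⟨b, hb⟩ := hQ
  refine ⟨Function.extend Fin.val p fun _ => b, fun k => ?_,
    funext fun i => (Fin.val_injective.extend_apply _ _ i).symm⟩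
  by_cases hk : ∃ i : Fin j, i.val = k
  · obtain ⟨i, rfl⟩ := hk
    rw [Fin.val_injective.extend_apply]
    exact hp i
  · rwa [Function.extend_apply' _ _ _ hk]

variable [IsProbabilityMeasure P] {n : ℕ} {X : ℝ≥0 → Ω → Multiset ℕ} {S s L : ℕ → Ω → ℕ}
  {τ : ℕ → Ω → ℝ}

/- The law of the sizes and of the holding times is given only on the events where the latter are
positive, so it bounds the probabilities of the paths of sizes from below; these lower bounds
already sum to one. -/
lemma IsMarcusLushnikov.measureReal_sizes {K : ℕ → ℕ → ℝ} {I : ℕ → Multiset ℕ → Prop}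
    (hX : IsMarcusLushnikov K n P X S s τ)
    (hK : IsFiniteChain (pairWeight K n) (fun m a => merge m a.1 a.2) (pairSupport n) I)
    (hI : I (n - 1) (Multiset.replicate n 1)) {p : Fin (n - 1) → ℕ × ℕ}
    (hp : p ∈ Fintype.piFinset fun _ => pairSupport n) :
    P.real ((fun ω (i : Fin (n - 1)) => (S i ω, s i ω)) ⁻¹' {p}) =
      pathWeight (pairWeight K n) (fun m a => merge m a.1 a.2) (Multiset.replicate n 1) p := by
  have hY : Measurable fun ω (i : Fin (n - 1)) => (S i ω, s i ω) :=
    measurable_pi_lambda _ fun i => (hX.measurable_S i).prodMk (hX.measurable_s i)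
  refine measureReal_preimage_singleton_eq_of_le hY (fun p hp => ?_) (hK.sum_pathWeight hI) hp
  obtain ⟨a, hle, rfl⟩ := exists_extension_of_forall_fin (Q := fun b : ℕ × ℕ => b.2 ≤ b.1)
    ⟨0, le_rfl⟩ fun i => (Finset.mem_filter.1 (Fintype.mem_piFinset.1 hp i)).2
  have hlaw := hX.law (fun k => (a k).1) (fun k => (a k).2) 0 hle fun _ => le_rfl
  calc pathWeight (pairWeight K n) (fun m a => merge m a.1 a.2) (Multiset.replicate n 1)
        (fun i : Fin (n - 1) => a i)
      = P.real {ω | ∀ k < n - 1, S k ω = (a k).1 ∧ s k ω = (a k).2 ∧ 0 < τ k ω} := by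
        rw [measureReal_def]
        refine (Eq.trans (congrArg ENNReal.toReal hlaw) ?_).symm
        rw [ENNReal.toReal_prod, pathWeight_eq_prod]
        refine Finset.prod_congr rfl fun k _ => ?_
        rw [traj_merge, Pi.zero_apply, mul_zero, Real.exp_zero, mul_one]
        exact ENNReal.toReal_ofReal (hK.nonneg _ (a k))
    _ ≤ _ := measureReal_mono fun ω hω =>
        funext fun i : Fin (n - 1) => Prod.ext (hω i i.2).1 (hω i i.2).2.1

section Additive

variable (hX : IsMarcusLushnikov additiveKernel n P X S s τ) (hL : IsSizeBiasedPick n P S s L)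
  (hn : 1 ≤ n)

include hX hL hn

lemma measureReal_picks {p : Fin (n - 1) → (ℕ × ℕ) × ℕ}
    (hp : p ∈ Fintype.piFinset fun _ => pickSupport n) :
    P.real ((fun ω (i : Fin (n - 1)) => ((S i ω, s i ω), L i ω)) ⁻¹' {p}) =
      pathWeight (pickWeight n) (fun m a => merge m a.1.1 a.1.2) (Multiset.replicate n 1) p := by
  obtain ⟨a, rfl⟩ : ∃ a : ℕ → (ℕ × ℕ) × ℕ, (fun i : Fin (n - 1) => a i) = p :=
    Fin.val_injective.surjective_comp_right p
  have hsizes := hX.measureReal_sizes (isFiniteChain_pairWeight n) (isState_replicate hn)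
    (p := fun i : Fin (n - 1) => (a i).1) (Fintype.mem_piFinset.2 fun i =>
      (Finset.mem_product.1 (Fintype.mem_piFinset.1 hp i)).1)
  have hlaw := hL.law (fun k => (a k).1.1) (fun k => (a k).1.2) (fun k => (a k).2)
  have hpre : (fun ω (i : Fin (n - 1)) => ((S i ω, s i ω), L i ω)) ⁻¹'
      {fun i : Fin (n - 1) => a i} =
      {ω | ∀ k < n - 1, S k ω = (a k).1.1 ∧ s k ω = (a k).1.2 ∧ L k ω = (a k).2} := by
    ext ω
    simp [funext_iff, Fin.forall_iff, Prod.ext_iff, and_assoc]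
  have hpre' : (fun ω (i : Fin (n - 1)) => (S i ω, s i ω)) ⁻¹'
      {fun i : Fin (n - 1) => (a i).1} =
      {ω | ∀ k < n - 1, S k ω = (a k).1.1 ∧ s k ω = (a k).1.2} := by
    ext ω
    simp [funext_iff, Fin.forall_iff, Prod.ext_iff]
  rw [hpre, measureReal_def, hlaw, ENNReal.toReal_mul, ← measureReal_def, ← hpre', hsizes,
    pathWeight_eq_prod _ _ _ fun k => (a k).1, pathWeight_eq_prod, ENNReal.toReal_prod,
    ← Finset.prod_mul_distrib]
  refine Finset.prod_congr rfl fun k _ => ?_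
  rw [traj_merge, traj_merge, ENNReal.toReal_ofReal (sizeBiased_nonneg _ _ _), pickWeight]

lemma lintegral_ofReal_picks_eq_pathSum {F : (Fin (n - 1) → (ℕ × ℕ) × ℕ) → ℝ}
    (hF : ∀ p, 0 ≤ F p) :
    ∫⁻ ω, ENNReal.ofReal (F fun i => ((S i ω, s i ω), L i ω)) ∂P =
      ENNReal.ofReal (pathSum (pickWeight n) (fun m a => merge m a.1.1 a.1.2) (pickSupport n) F
        (Multiset.replicate n 1)) := by
  have hY : Measurable fun ω (i : Fin (n - 1)) => ((S i ω, s i ω), L i ω) :=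
    measurable_pi_lambda _ fun i =>
      ((hX.measurable_S i).prodMk (hX.measurable_s i)).prodMk (hL.measurable_L i)
  exact lintegral_ofReal_comp_eq_sum hY (fun _ hp => measureReal_picks hX hL hn hp)
    ((isFiniteChain_pickWeight n).sum_pathWeight (isState_replicate hn)) hF

end Additive

end Law

section Asymptotics

lemma cast_harmonic_eq_sum (n : ℕ) :
    (harmonic n : ℝ) = ∑ i ∈ Finset.range n, 1 / ((i : ℝ) + 1) := by
  simp [harmonic]

lemma sum_target (r j : ℕ) :
    ∑ i ∈ Finset.range j, target r i = ∑ i ∈ Finset.Ico r j, 1 / ((i : ℝ) + 1) := by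
  simp only [target, ← Finset.sum_filter]
  congr 1
  ext i
  simp only [Finset.mem_filter, Finset.mem_range, Finset.mem_Ico, and_comm]

lemma offset_le (r j : ℕ) : offset r j ≤ 8 - 4 * ∑ i ∈ Finset.range j, target r i := by
  have hsq : ∑ i ∈ Finset.Ico r j, 1 / ((i : ℝ) + 1) ^ 2 ≤ 2 / ((r : ℝ) + 1) := by
    refine le_of_eq_of_le ?_ (sum_Ioo_inv_sq_le r (j + 1))
    rw [← Order.succ_eq_add_one, ← Finset.Ico_succ_left_eq_Ioo, Order.succ_eq_add_one,
      Order.succ_eq_add_one, ← Finset.sum_Ico_add']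
    simp
  have hscale : 4 * ((r : ℝ) + 1) * ∑ i ∈ Finset.Ico r j, 1 / ((i : ℝ) + 1) ^ 2 ≤ 8 :=
    (mul_le_mul_of_nonneg_left hsq (by positivity)).trans_eq (by field_simp; norm_num)
  calc offset r j = 4 * ((r : ℝ) + 1) * ∑ i ∈ Finset.Ico r j, 1 / ((i : ℝ) + 1) ^ 2 -
        4 * ∑ i ∈ Finset.Ico r j, 1 / ((i : ℝ) + 1) := by
        simp only [offset, Finset.mul_sum, ← Finset.sum_sub_distrib, mul_one_div]
    _ ≤ _ := by linarith [sum_target r j]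

section Initial

variable {n : ℕ} (hn : 1 ≤ n)

include hn

lemma cast_harmonic_pred_mem_Icc :
    (harmonic (n - 1) : ℝ) ∈ Set.Icc (Real.log n) (1 + Real.log n) := by
  obtain ⟨j, rfl⟩ := Nat.exists_eq_add_of_le' hn
  rw [Nat.add_sub_cancel]
  refine ⟨log_add_one_le_harmonic j, (harmonic_le_one_add_log j).trans ?_⟩
  refine add_le_add_right ?_ 1
  obtain rfl | hj := j.eq_zero_or_pos
  · simp
  · exact Real.log_le_log (Nat.cast_pos.2 hj) (Nat.cast_le.2 j.le_succ)

lemma abs_sum_target_sqrt_sub_le :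
    |∑ i ∈ Finset.range (n - 1), target (Nat.sqrt n) i - Real.log n / 2| ≤ 1 := by
  obtain rfl | hn' := hn.eq_or_lt
  · simp
  have hr : Nat.sqrt n ≤ n - 1 := Nat.le_sub_one_of_lt (Nat.sqrt_lt_self hn')
  have hr₀ : (0 : ℝ) < Nat.sqrt n := Nat.cast_pos.2 (Nat.sqrt_pos.2 hn)
  have hlog_le : Real.log (Nat.sqrt n) ≤ Real.log n / 2 := by
    rw [← Real.log_sqrt n.cast_nonneg]
    exact Real.log_le_log hr₀ Real.nat_sqrt_le_real_sqrt
  have hle_log : Real.log n / 2 ≤ Real.log (Nat.sqrt n + 1) := by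
    rw [← Real.log_sqrt n.cast_nonneg]
    exact Real.log_le_log (by positivity) Real.real_sqrt_le_nat_sqrt_succ
  have hlower := log_add_one_le_harmonic (Nat.sqrt n)
  have hupper := harmonic_le_one_add_log (Nat.sqrt n)
  obtain ⟨hlower', hupper'⟩ := cast_harmonic_pred_mem_Icc hn
  rw [Nat.cast_add_one] at hlower
  rw [sum_target, Finset.sum_Ico_eq_sub _ hr, ← cast_harmonic_eq_sum, ← cast_harmonic_eq_sum,
    abs_le]
  constructor <;> linarith

lemma slope_sqrt_mul_le : slope (Nat.sqrt n) (n - 1) * (1 / n) ≤ 5 := by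
  have hn₀ : (n : ℝ) ≠ 0 := by positivity
  have hsub : ((n - 1 - Nat.sqrt n : ℕ) : ℝ) ≤ n := Nat.cast_le.2 (by lia)
  have hsqrt : (n : ℝ) ≤ (Nat.sqrt n + 1) * (Nat.sqrt n + 1) := by
    exact_mod_cast (Nat.lt_succ_sqrt n).le
  rw [slope, Nat.cast_pred hn, sub_add_cancel, div_mul_eq_mul_div, div_le_iff₀ (by positivity)]
  calc 5 * (n : ℝ) * (n - 1 - Nat.sqrt n : ℕ) * (1 / n)
      = 5 * (n - 1 - Nat.sqrt n : ℕ) := by field_simp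
    _ ≤ 5 * ((Nat.sqrt n + 1) * (Nat.sqrt n + 2)) := by nlinarith

lemma potential_sqrt_replicate_le :
    potential n (Nat.sqrt n) (n - 1) (Multiset.replicate n 1) ≤ 17 := by
  have hn₀ : (n : ℝ) ≠ 0 := by positivity
  have hq : relSum n 2 (Multiset.replicate n 1) = 1 / n := by
    rw [relSum_replicate, sq, ← mul_assoc, mul_one_div_cancel hn₀, one_mul]
  have hlog : Real.log (1 / n) = -Real.log n := by rw [one_div, Real.log_inv]
  rw [potential, hq, hlog]
  linarith [slope_sqrt_mul_le hn, offset_le (Nat.sqrt n) (n - 1),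
    (abs_le.1 (abs_sum_target_sqrt_sub_le hn)).1]

lemma pathSum_prey_sub_log_sq_le :
    pathSum (pickWeight n) (fun m a => merge m a.1.1 a.1.2) (pickSupport n)
        (fun p : Fin (n - 1) → (ℕ × ℕ) × ℕ => (∑ i, prey n (p i) - Real.log n / 2) ^ 2)
        (Multiset.replicate n 1) ≤
      37 * (2 + Real.log n) := by
  set T := ∑ i ∈ Finset.range (n - 1), target (Nat.sqrt n) i
  have hd : |T - Real.log n / 2| ≤ 1 := abs_sum_target_sqrt_sub_le hn
  have hlog : 0 ≤ Real.log n := Real.log_natCast_nonneg n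
  have hstate := isState_replicate hn
  have key := hstate.pathSum_prey_sq_le (Nat.sqrt n) (d := T - Real.log n / 2)
    (H := 2 + Real.log n) (by linarith) (by
      linarith [cast_harmonic_eq_sum (n - 1), (cast_harmonic_pred_mem_Icc hn).2])
  calc _ = _ := by
        congr 1
        funext p
        ring
    _ ≤ _ := key
    _ ≤ 37 * (2 + Real.log n) := by
        nlinarith [hstate.relSum_two_pos, potential_sqrt_replicate_le hn]

end Initial

section Law

variable {Ω : Type*}

lemma costQFB_div (S s L : ℕ → Ω → ℕ) (n j : ℕ) (ω : Ω) :
    costQFB S s L j ω / n = ∑ i : Fin j, prey n ((S i ω, s i ω), L i ω) := by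
  simp only [costQFB, preySize, prey, Finset.sum_div, Finset.sum_range]

variable [MeasurableSpace Ω] {P : Measure Ω}

lemma eLpNorm_two_le_of_lintegral_sq_le {f : Ω → ℝ} {c : ℝ}
    (hc : 0 ≤ c) (h : ∫⁻ ω, ENNReal.ofReal (f ω ^ 2) ∂P ≤ ENNReal.ofReal c) :
    eLpNorm f 2 P ≤ ENNReal.ofReal √c := by
  have hsq : ∀ ω, ‖f ω‖ₑ ^ (2 : ℝ) = ENNReal.ofReal (f ω ^ 2) := fun ω => by
    rw [ENNReal.rpow_two, ← Real.enorm_eq_ofReal (sq_nonneg _), enorm_pow]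
  rw [eLpNorm_eq_lintegral_rpow_enorm_toReal two_ne_zero ENNReal.ofNat_ne_top,
    ENNReal.toReal_ofNat, Real.sqrt_eq_rpow,
    ← ENNReal.ofReal_rpow_of_nonneg hc (by norm_num)]
  simp only [hsq]
  gcongr

lemma eLpNorm_costQFB_le [IsProbabilityMeasure P] {n : ℕ} (hn : 2 ≤ n)
    {X : ℝ≥0 → Ω → Multiset ℕ} {S s L : ℕ → Ω → ℕ} {τ : ℕ → Ω → ℝ}
    (hX : IsMarcusLushnikov additiveKernel n P X S s τ) (hL : IsSizeBiasedPick n P S s L) :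
    eLpNorm (fun ω => costQFB S s L (n - 1) ω / (n * Real.log n) - 1 / 2) 2 P ≤
      ENNReal.ofReal (√(37 * (2 + Real.log n)) / Real.log n) := by
  have hn₁ : 1 ≤ n := one_le_two.trans hn
  have hlog : 0 < Real.log n := Real.log_pos (Nat.one_lt_cast.2 hn)
  have hscale : (fun ω => costQFB S s L (n - 1) ω / (n * Real.log n) - 1 / 2) =
      (Real.log n)⁻¹ • fun ω => costQFB S s L (n - 1) ω / n - Real.log n / 2 := by
    funext ω
    simp only [Pi.smul_apply, smul_eq_mul]
    field_simp
  have hL2 : eLpNorm (fun ω => costQFB S s L (n - 1) ω / n - Real.log n / 2) 2 P ≤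
      ENNReal.ofReal √(37 * (2 + Real.log n)) := by
    refine eLpNorm_two_le_of_lintegral_sq_le (by positivity) ?_
    simp only [costQFB_div]
    have hlaw := lintegral_ofReal_picks_eq_pathSum hX hL hn₁
      (F := fun p => (∑ i, prey n (p i) - Real.log n / 2) ^ 2) fun _ => sq_nonneg _
    exact hlaw.trans_le (ENNReal.ofReal_le_ofReal (pathSum_prey_sub_log_sq_le hn₁))
  rw [hscale, eLpNorm_const_smul, Real.enorm_eq_ofReal (inv_nonneg.2 hlog.le), div_eq_inv_mul √_,
    ENNReal.ofReal_mul (inv_nonneg.2 hlog.le)]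
  gcongr

end Law

lemma tendsto_sqrt_mul_add_div_atTop (a b : ℝ) :
    Tendsto (fun x : ℝ => √(a * (b + x)) / x) atTop (𝓝 0) := by
  have hlim : Tendsto (fun x : ℝ => a * b / x ^ 2 + a / x) atTop (𝓝 0) := by
    have hsq : Tendsto (fun x : ℝ => a * b / x ^ 2) atTop (𝓝 0) :=
      tendsto_const_nhds.div_atTop (tendsto_pow_atTop two_ne_zero)
    simpa only [add_zero, id_eq] using hsq.add (tendsto_const_nhds.div_atTop tendsto_id)
  refine (Real.sqrt_zero ▸ hlim.sqrt).congr' ?_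
  filter_upwards [eventually_gt_atTop 0] with x hx
  have hsum : a * b / x ^ 2 + a / x = a * (b + x) / x ^ 2 := by field_simp
  rw [hsum, Real.sqrt_div' _ (sq_nonneg x), Real.sqrt_sq hx.le]

end Asymptotics

end MarcusLushnikov

end

theorem mainTheorem4 {Ω : ℕ → Type*} [∀ n, MeasurableSpace (Ω n)]
    (P : ∀ n, Measure (Ω n)) [∀ n, IsProbabilityMeasure (P n)]
    (X : ∀ n, ℝ≥0 → Ω n → Multiset ℕ) (S s : ∀ n, ℕ → Ω n → ℕ)
    (τ : ∀ n, ℕ → Ω n → ℝ) (L : ∀ n, ℕ → Ω n → ℕ)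
    (hX : ∀ n, MarcusLushnikov.IsMarcusLushnikov MarcusLushnikov.additiveKernel n (P n)
      (X n) (S n) (s n) (τ n))
    (hL : ∀ n, MarcusLushnikov.IsSizeBiasedPick n (P n) (S n) (s n) (L n)) :
    Tendsto (fun n : ℕ => eLpNorm (fun ω =>
        MarcusLushnikov.costQFB (S n) (s n) (L n) (n - 1) ω / ((n : ℝ) * Real.log n) - 1 / 2)
      2 (P n)) atTop (𝓝 0) := by
  have hbound : ∀ᶠ n : ℕ in atTop, eLpNorm (fun ω =>
      MarcusLushnikov.costQFB (S n) (s n) (L n) (n - 1) ω / ((n : ℝ) * Real.log n) - 1 / 2)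
      2 (P n) ≤ ENNReal.ofReal (√(37 * (2 + Real.log n)) / Real.log n) :=
    (eventually_ge_atTop 2).mono fun n hn => MarcusLushnikov.eLpNorm_costQFB_le hn (hX n) (hL n)
  have hlog : Tendsto (fun n : ℕ => Real.log n) atTop atTop :=
    Real.tendsto_log_atTop.comp tendsto_natCast_atTop_atTop
  have hlim := ENNReal.tendsto_ofReal
    ((MarcusLushnikov.tendsto_sqrt_mul_add_div_atTop 37 2).comp hlog)
  rw [ENNReal.ofReal_zero] at hlim
  exact tendsto_of_tendsto_of_tendsto_of_le_of_le' tendsto_const_nhds hlim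
    (Eventually.of_forall fun _ => zero_le) hbound
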